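/- Let $K$ be a global function field over a finite field $k$, and let $\Sigma_K$ be the set of all places of $K$. For $v\in\Sigma_K$ let $K_v$ be the completion of $K$ at $v$. Let $\Sigma\subset\Sigma_K$ be a cofinite subset, put $S=\Sigma_K\setminus\Sigma$, and let $O_S=\{x\in K : x \text{ is integral at every } v\notin S\}$ be the ring of $S$-integers of $K$, with unit group $O_S^*$. Let $\Gamma\subset O_S^*$ be a subgroup that is free of rank one, and let $k(\Gamma)$ be the smallest subfield of $K$ containing $k$ and $\Gamma$. Endow $\prod_{v\in\Sigma}K_v^*$ with the product topology, and embed $\Gamma\subset K^*$ in it diagonally; let $\overline{\Gamma}$ be the topological closure of $\Gamma$ in $\prod_{v\in\Sigma}K_v^*$. Let $M$ be a natural number and let $W$ be a closed subvariety of the affine space $\mathbb A^M$ defined by polynomials with coefficients in $k(\Gamma)$. Write $W(\Theta)$ for the set of points of $W$ with all coordinates in $\Theta$, and let $\overline{W(\Gamma)}$ be the topological closure of the diagonal image of $W(\Gamma)$ in $\bigl(\prod_{v\in\Sigma}K_v^*\bigr)^M$. Then $$W(\overline{\Gamma})=\overline{W(\Gamma)}.$$ -/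

import Mathlib

open scoped RatFunc

noncomputable section

/-- A place of the function field `K` over `k`: a valuation ring of `K` that contains `k` and is
different from `K`. -/
structure FFPlace (k K : Type*) [Field k] [Field K] [Algebra k K] where
  valRing : ValuationSubring K
  algebraMap_mem : ∀ c : k, algebraMap k K c ∈ valRing
  ne_top : valRing ≠ ⊤

namespace FFPlace

variable {k K : Type*} [Field k] [Field K] [Algebra k K]

/-- The completion `K_v` of `K` at the place `v`. -/
abbrev Completion (v : FFPlace k K) : Type _ := v.valRing.valuation.Completion

/-- The canonical embedding of `K` into `K_v`. -/
def embed (v : FFPlace k K) : K →+* v.Completion :=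
  UniformSpace.Completion.coeRingHom.comp (WithVal.equiv v.valRing.valuation).symm.toRingHom

/-- The ring `O_S` of `S`-integers of `K`: the elements that are integral at every place
outside `S`. -/
def sIntegers (S : Set (FFPlace k K)) : Subring K := ⨅ v ∈ Sᶜ, v.valRing.toSubring

/-- The group `O_S^*`, as a subgroup of `K^*`. -/
def sUnits (S : Set (FFPlace k K)) : Subgroup Kˣ := (sIntegers S).toSubmonoid.units

/-- The product `∏_{v ∈ T} K_v`, a ring. -/
abbrev ProdCompletion (T : Set (FFPlace k K)) : Type _ := ∀ v : T, (v : FFPlace k K).Completion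

/-- The product `∏_{v ∈ T} K_v^*` of unit groups; it carries the product of the topologies
of the topological groups `K_v^*`. -/
abbrev ProdUnits (T : Set (FFPlace k K)) : Type _ := ∀ v : T, ((v : FFPlace k K).Completion)ˣ

/-- The diagonal embedding of `K` into `∏_{v ∈ T} K_v`. -/
def diag (T : Set (FFPlace k K)) : K →+* ProdCompletion T :=
  RingHom.pi fun v => (v : FFPlace k K).embed

/-- The diagonal embedding of `K^*` into `∏_{v ∈ T} K_v^*`. -/
def diagUnits (T : Set (FFPlace k K)) : Kˣ →* ProdUnits T :=
  MonoidHom.pi fun v => Units.map ((v : FFPlace k K).embed : K →* _)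

/-- The inclusion of `∏_{v ∈ T} K_v^*` into `∏_{v ∈ T} K_v`. -/
def ProdUnits.toProd {T : Set (FFPlace k K)} (x : ProdUnits T) : ProdCompletion T :=
  fun v => (x v : (v : FFPlace k K).Completion)

/-- The closure of `Γ` in `∏_{v ∈ T} K_v^*`. -/
def closureGroup (Γ : Subgroup Kˣ) (T : Set (FFPlace k K)) : Set (ProdUnits T) :=
  closure (diagUnits T '' (Γ : Set Kˣ))

end FFPlace

/-- The field `k(Γ)`: the smallest subfield of `K` that contains `k` and `Γ`. -/
abbrev fieldGen (k : Type*) {K : Type*} [Field k] [Field K] [Algebra k K] (Γ : Subgroup Kˣ) :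
    IntermediateField k K :=
  IntermediateField.adjoin k ((fun u : Kˣ => (u : K)) '' (Γ : Set Kˣ))

namespace ClosedVariety

open FFPlace

variable {k K : Type*} [Field k] [Field K] [Algebra k K] {F : IntermediateField k K} {M : ℕ}

/-- A point `x` with coordinates in the ring `R` lies on the closed subvariety of affine `M`-space
cut out by the ideal `W` of `F[X₁, …, X_M]`; here `R` contains `K` via `φ`. -/
def HasPoint (W : Ideal (MvPolynomial (Fin M) F)) {R : Type*} [CommRing R] (φ : K →+* R)
    (x : Fin M → R) : Prop :=
  ∀ f ∈ W, MvPolynomial.eval₂ (φ.comp (algebraMap F K)) x f = 0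

/-- `W(Γ)`: the points of `W` all of whose coordinates lie in `Γ ⊆ K^*`. -/
def points (W : Ideal (MvPolynomial (Fin M) F)) (Γ : Subgroup Kˣ) : Set (Fin M → Kˣ) :=
  {x | (∀ i, x i ∈ Γ) ∧ HasPoint W (RingHom.id K) fun i => (x i : K)}

/-- `W(Θ)` for a subset `Θ` of `∏_{v ∈ T} K_v^*`: the points of `W` with values in the ring
`∏_{v ∈ T} K_v` all of whose coordinates lie in `Θ`. -/
def adelicPoints (W : Ideal (MvPolynomial (Fin M) F)) {T : Set (FFPlace k K)}
    (Θ : Set (ProdUnits T)) : Set (Fin M → ProdUnits T) :=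
  {x | (∀ i, x i ∈ Θ) ∧ HasPoint W (diag T) fun i => (x i).toProd}

/-- The closure of (the diagonal image of) `W(Γ)` in `(∏_{v ∈ T} K_v^*)^M`. -/
def closurePoints (W : Ideal (MvPolynomial (Fin M) F)) (Γ : Subgroup Kˣ)
    (T : Set (FFPlace k K)) : Set (Fin M → ProdUnits T) :=
  closure ((fun x : Fin M → Kˣ => fun i => diagUnits T (x i)) '' points W Γ)

end ClosedVariety

end

/-! ### Sparse polynomials divisible by powers of cyclotomic-type factors -/

section PolynomialLemmas

open Polynomial

/-! Write Γ = ⟨g⟩; since k is finite, g is transcendental over k. The inclusion of the closure of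
W(Γ) is the easy one, since lying on W is a closed condition. For the other, a point x of W with
coordinates in the closure of Γ is a limit of tuples (g ^ a₁, …, g ^ a_M) along an ultrafilter on
ℤ^M. After clearing denominators, the finitely many equations of W become exponential sums ∑ cⱼ g ^
(eⱼ + mⱼ·a) with cⱼ in k, and these tend to zero at every place of Σ.

The core is `sum_coeff_eq_zero_of_tendsto`: if the terms are grouped by the profinite limit of their
exponents, the coefficients in each group sum to zero. To see this, reduce the exponents modulo a
suitable N = N₀ p^s N₁. The resulting polynomial has degree less than N and fewer than N₁ terms.
Convergence at the places over the irreducible factors of Φ = (X^(N₀N₁) - 1)/(X^N₀ - 1) makes it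
divisible by Φ^(p^s), a polynomial in X^(N₀p^s) with N₁ terms. A nonzero multiple of that in this
degree has at least N₁ terms, so the polynomial is zero.

It remains to find integer exponents near the limit at which the exponents of each group coincide.
This is an integral linear system solvable modulo every n, hence solvable
(`exists_int_solution_of_forall_mod`). At such exponents all the sums vanish exactly, which gives a
point of W(Γ) close to x. -/

theorem Squarefree.pow_dvd_of_forall_irreducible {R : Type*} [CommRing R] [IsDomain R]
    [IsPrincipalIdealRing R] {Φ g : R} (hΦ : Squarefree Φ) (hΦ0 : Φ ≠ 0) {q : ℕ}
    (h : ∀ P, Irreducible P → P ∣ Φ → P ^ q ∣ g) : Φ ^ q ∣ g := by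
  induction Φ using WfDvdMonoid.induction_on_irreducible with
  | zero => exact absurd rfl hΦ0
  | unit u hu => exact (hu.pow q).dvd
  | mul a P ha hP ih =>
    rw [mul_pow]
    refine IsCoprime.mul_dvd (IsCoprime.pow ?_) (h P hP (dvd_mul_right _ _))
      (ih (hΦ.squarefree_of_dvd (dvd_mul_left _ _)) ha
        fun Q hQ hQa => h Q hQ (hQa.mul_left _))
    rw [hP.coprime_iff_not_dvd]
    intro hPa
    exact hP.not_isUnit (hΦ P (mul_dvd_mul_left P hPa))

/-- The degree bound forces a nonzero cofactor `h` to have degree less than `D`. Its `n` shifts by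
multiples of `D` therefore do not overlap, and its leading coefficient survives at `n` distinct
exponents. -/
theorem Polynomial.eq_zero_of_geomSum_dvd {k : Type*} [Field k] {g : k[X]} {D n : ℕ}
    (hdvd : (∑ i ∈ Finset.range n, (X : k[X]) ^ (D * i)) ∣ g) (hdeg : g.natDegree < D * n)
    (hsupp : g.support.card < n) : g = 0 := by
  obtain ⟨h, rfl⟩ := hdvd
  by_contra hg
  have hD : 0 < D := Nat.pos_of_ne_zero fun h0 => by simp [h0] at hdeg
  have hn : 0 < n := by omega
  have hh : h ≠ 0 := right_ne_zero_of_mul hg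
  have hΨ : D * (n - 1) ≤ (∑ i ∈ Finset.range n, (X : k[X]) ^ (D * i)).natDegree := by
    apply le_natDegree_of_ne_zero
    rw [finsetSum_coeff, Finset.sum_eq_single (n - 1)]
    · simp
    · intro i _ hi
      rw [coeff_X_pow, if_neg]
      intro h'
      exact hi (Nat.eq_of_mul_eq_mul_left hD h').symm
    · intro h'
      simp at h'
      omega
  rw [natDegree_mul (left_ne_zero_of_mul hg) hh] at hdeg
  have hhD : h.natDegree < D := by
    obtain ⟨m, rfl⟩ : ∃ m, n = m + 1 := ⟨n - 1, by omega⟩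
    simp only [Nat.add_sub_cancel, mul_add, mul_one] at hΨ hdeg
    omega
  have hcoeff : ∀ i < n, ((∑ i ∈ Finset.range n, (X : k[X]) ^ (D * i)) * h).coeff
      (D * i + h.natDegree) = h.leadingCoeff := by
    intro i hi
    rw [Finset.sum_mul, finsetSum_coeff, Finset.sum_eq_single i]
    · rw [coeff_X_pow_mul', if_pos (by omega)]
      simp
    · intro j _ hj
      rw [coeff_X_pow_mul']
      split_ifs with hle
      · apply coeff_eq_zero_of_natDegree_lt
        rcases lt_or_gt_of_ne hj with hlt | hlt
        · have : D * (j + 1) ≤ D * i := Nat.mul_le_mul_left D hlt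
          rw [mul_add] at this
          omega
        · have : D * (i + 1) ≤ D * j := Nat.mul_le_mul_left D hlt
          rw [mul_add] at this
          omega
      · rfl
    · intro h'
      exact absurd (Finset.mem_range.mpr hi) h'
  have hsub : (Finset.range n).image (fun i => D * i + h.natDegree) ⊆
      ((∑ i ∈ Finset.range n, (X : k[X]) ^ (D * i)) * h).support := by
    intro j hj
    obtain ⟨i, hi, rfl⟩ := Finset.mem_image.mp hj
    rw [mem_support_iff, hcoeff i (Finset.mem_range.mp hi)]
    exact leadingCoeff_ne_zero.mpr hh
  have hcard := Finset.card_le_card hsub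
  rw [Finset.card_image_of_injective, Finset.card_range] at hcard
  · omega
  · intro i j hij
    exact Nat.eq_of_mul_eq_mul_left hD (by simpa using hij)

/-- Let `Φ = (X ^ (N₀ N₁) - 1) / (X ^ N₀ - 1)`. A polynomial of degree less than `N₀ q N₁`
with fewer than `N₁` terms vanishes as soon as it is divisible by `P ^ q` for every
irreducible factor `P` of `Φ`. -/
theorem Polynomial.eq_zero_of_forall_irreducible_pow_dvd {k : Type*} [Field k] {p : ℕ}
    [Fact p.Prime] [CharP k p] {N₀ N₁ s : ℕ} (hN₀ : ¬ p ∣ N₀) (hN₁ : ¬ p ∣ N₁) {g : k[X]}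
    (hdeg : g.natDegree < N₀ * p ^ s * N₁) (hsupp : g.support.card < N₁)
    (h : ∀ P : k[X], Irreducible P → P ∣ X ^ (N₀ * N₁) - 1 → ¬ P ∣ X ^ N₀ - 1 →
      P ^ (p ^ s) ∣ g) : g = 0 := by
  set Φ : k[X] := ∑ i ∈ Finset.range N₁, (X ^ N₀) ^ i with hΦdef
  have hΦmul : Φ * (X ^ N₀ - 1) = X ^ (N₀ * N₁) - 1 := by
    rw [hΦdef, geom_sum_mul, pow_mul]
  have hcast : ((N₀ * N₁ : ℕ) : k) ≠ 0 := by
    rw [Ne, CharP.cast_eq_zero_iff k p, (Fact.out : p.Prime).dvd_mul]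
    tauto
  have hsep := (X_pow_sub_one_separable_iff (F := k)).mpr hcast
  have hΦsq : Squarefree Φ := hsep.squarefree.squarefree_of_dvd ⟨_, hΦmul.symm⟩
  have hΦpow : Φ ^ p ^ s = ∑ i ∈ Finset.range N₁, (X : k[X]) ^ (N₀ * p ^ s * i) := by
    rw [hΦdef, sum_pow_char_pow]
    refine Finset.sum_congr rfl fun i _ => ?_
    rw [← pow_mul, ← pow_mul]
    ring
  refine eq_zero_of_geomSum_dvd (D := N₀ * p ^ s) (n := N₁) ?_ hdeg hsupp
  rw [← hΦpow]
  refine hΦsq.pow_dvd_of_forall_irreducible hΦsq.ne_zero fun P hP hPΦ => h P hP ?_ ?_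
  · rw [← hΦmul]
    exact hPΦ.mul_right _
  -- A common factor of `Φ` and `X ^ N₀ - 1` would divide the separable polynomial `X ^ (N₀ * N₁) -
  -- 1` twice.
  · intro hP0
    refine hP.not_isUnit (hsep.squarefree P ?_)
    rw [← hΦmul]
    exact mul_dvd_mul hPΦ hP0

end PolynomialLemmas

/-! ### Local-to-global solvability of integral linear systems -/

section IntegerLemmas

/-- By the structure theorem: a free coordinate divisible by every integer is zero, and a coordinate
in `ZMod (p ^ e)` is killed by taking `n = p ^ e`. -/
theorem AddCommGroup.eq_zero_of_forall_exists_nsmul {G : Type*} [AddCommGroup G]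
    [Module.Finite ℤ G] {c : G} (h : ∀ n : ℕ, 0 < n → ∃ g : G, c = n • g) : c = 0 := by
  have : AddGroup.FG G := Module.Finite.iff_addGroup_fg.mp inferInstance
  obtain ⟨r, ι, _, p, hp, e, ⟨f⟩⟩ := AddCommGroup.equiv_free_prod_directSum_zmod G
  rw [← f.map_eq_zero_iff]
  refine Prod.ext (Finsupp.ext fun i => ?_) (DFinsupp.ext fun i => ?_)
  · have hdvd : ∀ n : ℕ, 0 < n → (n : ℤ) ∣ (f c).1 i := fun n hn => by
      obtain ⟨g, rfl⟩ := h n hn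
      exact ⟨(f g).1 i, by simp⟩
    have := Int.eq_zero_of_abs_lt_dvd (hdvd (((f c).1 i).natAbs + 1) (by omega)) (by
      rw [Int.abs_eq_natAbs]; push_cast; omega)
    simpa using this
  · obtain ⟨g, rfl⟩ := h (p i ^ e i) (pow_pos (hp i).pos _)
    have : ((p i ^ e i : ℕ) : ZMod (p i ^ e i)) = 0 := ZMod.natCast_self _
    rw [map_nsmul]
    change (p i ^ e i) • ((f g).2 i) = 0
    rw [nsmul_eq_mul, this, zero_mul]

/-- An integral linear system that is solvable modulo every integer, by vectors in a given
residue class modulo `N`, has an integral solution in that residue class. -/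
theorem exists_int_solution_of_forall_mod {V H : Type*} [AddCommGroup V] [AddCommGroup H]
    [Module.Finite ℤ H] (L : V →+ H) (b : H) (a₀ : V) (N : ℕ)
    (h : ∀ n : ℕ, 0 < n → ∃ a y : V, ∃ z : H, a = a₀ + N • y ∧ L a = b + n • z) :
    ∃ y : V, L (a₀ + N • y) = b := by
  -- The claim is that `b - L a₀` lies in `R`. The hypothesis makes its class in the finitely
  -- generated group `H ⧸ R` divisible by every `n`.
  let R : AddSubgroup H := (N • L).range
  have key : (QuotientAddGroup.mk (b - L a₀) : H ⧸ R) = 0 := by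
    have : Module.Finite ℤ (H ⧸ R) :=
      Module.Finite.of_surjective (QuotientAddGroup.mk' R).toIntLinearMap
        (QuotientAddGroup.mk'_surjective R)
    refine AddCommGroup.eq_zero_of_forall_exists_nsmul fun n hn => ?_
    obtain ⟨a, y, z, rfl, hz⟩ := h n hn
    refine ⟨QuotientAddGroup.mk (-z), ?_⟩
    rw [← QuotientAddGroup.mk_nsmul, QuotientAddGroup.eq]
    refine ⟨-y, ?_⟩
    rw [map_add, map_nsmul] at hz
    simp only [AddMonoidHom.nsmul_apply, map_neg]
    have : b = L a₀ + N • L y - n • z := by rw [hz]; abel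
    rw [this]
    simp only [smul_neg]
    abel
  rw [QuotientAddGroup.eq_zero_iff] at key
  obtain ⟨y, hy⟩ := key
  refine ⟨y, ?_⟩
  rw [map_add, map_nsmul]
  have : N • L y = b - L a₀ := hy
  rw [this]
  abel

end IntegerLemmas

/-! ### Places of the function field and polynomials in one transcendental element -/

section Places

open Polynomial

variable {k K : Type*} [Field k] [Field K] [Algebra k K]

/-- The transcendence degree of `K` over `k` is one, so `γ` alone is a transcendence basis. -/
theorem FunctionField.isAlgebraic_adjoin_of_transcendental [Algebra k⟮X⟯ K]
    [IsScalarTower k k⟮X⟯ K] [FunctionField k K] {γ : K} (hγ : Transcendental k γ) :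
    Algebra.IsAlgebraic (Algebra.adjoin k {γ}) K := by
  have h1 : Algebra.trdeg k k⟮X⟯ = 1 := by
    have := lift_trdeg_add_eq k k[X] k⟮X⟯
    have h0 : Algebra.trdeg k[X] k⟮X⟯ = 0 := by
      have : Algebra.IsAlgebraic k[X] k⟮X⟯ := IsLocalization.isAlgebraic _ (nonZeroDivisors k[X])
      exact trdeg_eq_zero
    rw [h0, Polynomial.trdeg_of_isDomain] at this
    simpa using this.symm
  have h2 : Algebra.trdeg k K = 1 := by
    have := lift_trdeg_add_eq k k⟮X⟯ K
    have h0 : Algebra.trdeg k⟮X⟯ K = 0 := trdeg_eq_zero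
    rw [h0, h1] at this
    simpa using this.symm
  have hb : IsTranscendenceBasis k (fun _ : Unit => γ) := by
    refine AlgebraicIndependent.isTranscendenceBasis_of_lift_trdeg_le_of_finite ?_ ?_
    · rwa [algebraicIndependent_unique_type_iff]
    · simp [h2]
  have := hb.isAlgebraic
  rwa [Set.range_const] at this

/-- The quotient `k[X]/(a)` is finite, so two powers of `X` agree in it. -/
theorem Polynomial.exists_dvd_X_pow_sub_X_pow [Finite k] {a : k[X]} (ha : a ≠ 0) :
    ∃ i n : ℕ, 0 < n ∧ a ∣ X ^ i * (X ^ n - 1) := by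
  have : Module.Finite k (AdjoinRoot a) := (AdjoinRoot.powerBasis ha).finite
  have : Finite (AdjoinRoot a) := Module.finite_of_finite k
  obtain ⟨i, j, hne, hij⟩ :=
    Finite.exists_ne_map_eq_of_infinite fun i : ℕ => AdjoinRoot.mk a (X ^ i)
  wlog hlt : i < j generalizing i j
  · exact this j i hne.symm hij.symm (by omega)
  refine ⟨i, j - i, by omega, ?_⟩
  rw [mul_sub, ← pow_add, mul_one, Nat.add_sub_cancel' hlt.le]
  exact AdjoinRoot.mk_eq_mk.mp hij.symm

theorem transcendental_of_forall_pow_ne_one [Finite k] {γ : K} (hγ0 : γ ≠ 0)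
    (hγ : ∀ n : ℕ, 0 < n → γ ^ n ≠ 1) : Transcendental k γ := by
  rintro ⟨a, ha, haγ⟩
  obtain ⟨i, n, hn, b, hb⟩ := exists_dvd_X_pow_sub_X_pow ha
  have := congrArg (aeval γ) hb
  rw [map_mul, map_mul, haγ, zero_mul] at this
  simp only [map_pow, aeval_X, map_sub, map_one, mul_eq_zero, pow_eq_zero_iff', hγ0, false_and,
    false_or, sub_eq_zero] at this
  exact hγ n hn this

theorem Valuation.map_zpow_sub_one_le {Γ₀ : Type*} [LinearOrderedCommGroupWithZero Γ₀]
    (w : Valuation K Γ₀) {u : K} (hu : w u = 1) (b : ℤ) : w (u ^ b - 1) ≤ w (u - 1) := by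
  have hu0 : u ≠ 0 := by
    rintro rfl
    simp at hu
  induction b using Int.induction_on with
  | zero => simp
  | succ i ih =>
    have : u ^ ((i : ℤ) + 1) - 1 = u * (u ^ (i : ℤ) - 1) + (u - 1) := by
      rw [zpow_add₀ hu0, zpow_one]
      ring
    rw [this]
    refine w.map_add_le ?_ le_rfl
    rwa [map_mul, hu, one_mul]
  | pred i ih =>
    have : u ^ (-(i : ℤ) - 1) - 1 = u⁻¹ * ((u ^ (-(i : ℤ)) - 1) - (u - 1)) := by
      rw [zpow_sub₀ hu0, zpow_one]
      field_simp
      ring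
    rw [this, map_mul, map_inv₀, hu, inv_one, one_mul]
    exact w.map_sub_le ih le_rfl

namespace FFPlace

variable (v : FFPlace k K)

theorem valuation_algebraMap_le_one (c : k) : v.valRing.valuation (algebraMap k K c) ≤ 1 :=
  (v.valRing.valuation_le_one_iff _).mpr (v.algebraMap_mem c)

theorem valuation_algebraMap {c : k} (hc : c ≠ 0) :
    v.valRing.valuation (algebraMap k K c) = 1 := by
  refine le_antisymm (v.valuation_algebraMap_le_one c) ?_
  have h := v.valuation_algebraMap_le_one c⁻¹
  rw [map_inv₀, map_inv₀] at h
  have h0 : v.valRing.valuation (algebraMap k K c) ≠ 0 := by simpa using hc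
  exact (inv_le_one₀ (zero_lt_iff.mpr h0)).mp h

variable {v}

theorem aeval_mem {γ : K} (hγ : γ ∈ v.valRing) (a : k[X]) : aeval γ a ∈ v.valRing := by
  rw [aeval_eq_sum_range]
  refine sum_mem fun i _ => ?_
  rw [Algebra.smul_def]
  exact mul_mem (v.algebraMap_mem _) (pow_mem hγ _)

theorem valuation_aeval_le_one {γ : K} (hγ : γ ∈ v.valRing) (a : k[X]) :
    v.valRing.valuation (aeval γ a) ≤ 1 :=
  (v.valRing.valuation_le_one_iff _).mpr (aeval_mem hγ a)

theorem valuation_aeval_le_of_dvd {γ : K} (hγ : γ ∈ v.valRing) {a b : k[X]} (h : a ∣ b) :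
    v.valRing.valuation (aeval γ b) ≤ v.valRing.valuation (aeval γ a) := by
  obtain ⟨c, rfl⟩ := h
  rw [map_mul, map_mul]
  exact mul_le_of_le_one_right' (valuation_aeval_le_one hγ c)

theorem dvd_of_valuation_aeval_lt_one {γ : K} (hγ : γ ∈ v.valRing) {P Q : k[X]}
    (hP : Irreducible P) (hPv : v.valRing.valuation (aeval γ P) < 1)
    (hQv : v.valRing.valuation (aeval γ Q) < 1) : P ∣ Q := by
  by_contra hPQ
  obtain ⟨a, b, hab⟩ := hP.coprime_iff_not_dvd.mpr hPQ
  have h := congrArg (fun x => v.valRing.valuation (aeval γ x)) hab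
  simp only [map_one] at h
  refine absurd h (ne_of_lt ?_)
  rw [map_add]
  refine Valuation.map_add_lt _ ?_ ?_
  · exact (valuation_aeval_le_of_dvd hγ (dvd_mul_left P a)).trans_lt hPv
  · exact (valuation_aeval_le_of_dvd hγ (dvd_mul_left Q b)).trans_lt hQv

/-- At a place over `P`, polynomials in `γ` prime to `P` have value exactly 1, so the value of `g`
is governed by the multiplicity of `P` in `g`. This turns valuation estimates into divisibility. -/
theorem pow_dvd_of_valuation_aeval_le {γ : K} (hγ : γ ∈ v.valRing) (hγt : Transcendental k γ)
    {P g : k[X]} (hP : Irreducible P) (hPv : v.valRing.valuation (aeval γ P) < 1) {q : ℕ}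
    (hg : v.valRing.valuation (aeval γ g) ≤ v.valRing.valuation (aeval γ P) ^ q) : P ^ q ∣ g := by
  rcases eq_or_ne g 0 with rfl | hg0
  · exact dvd_zero _
  obtain ⟨r, b, hb, rfl⟩ := WfDvdMonoid.max_power_factor hg0 hP
  refine (pow_dvd_pow P ?_).mul_right b
  have hb1 : v.valRing.valuation (aeval γ b) = 1 :=
    le_antisymm (valuation_aeval_le_one hγ b)
      (not_lt.mp fun h => hb (dvd_of_valuation_aeval_lt_one hγ hP hPv h))
  have hP0 : 0 < v.valRing.valuation (aeval γ P) := by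
    rw [zero_lt_iff, Valuation.ne_zero_iff]
    exact fun h => hP.ne_zero ((transcendental_iff_injective.mp hγt) (by simpa using h))
  rw [map_mul, map_mul, hb1, mul_one, map_pow, map_pow] at hg
  exact (pow_le_pow_iff_right_of_lt_one₀ hP0 hPv).mp hg

/-- `P(γ)` generates a proper ideal of k[γ], and some valuation ring containing k[γ] has this ideal
among its nonunits. It is not all of `K`, because `P(γ)` is a nonzero nonunit. -/
theorem exists_place_of_irreducible {γ : K} (hγt : Transcendental k γ) {P : k[X]}
    (hP : Irreducible P) :
    ∃ v : FFPlace k K, γ ∈ v.valRing ∧ v.valRing.valuation (aeval γ P) < 1 := by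
  have hinj := transcendental_iff_injective.mp hγt
  let A : Subring K := (aeval (R := k) γ).range.toSubring
  have hmem : ∀ a : k[X], aeval γ a ∈ A := fun a => ⟨a, rfl⟩
  let I : Ideal A := Ideal.span {⟨aeval γ P, hmem P⟩}
  have hI : I ≠ ⊤ := by
    rw [Ne, Ideal.span_singleton_eq_top, isUnit_iff_exists_inv]
    rintro ⟨⟨_, b, rfl⟩, hb⟩
    have hb' : aeval γ (P * b) = aeval γ (1 : k[X]) := by
      rw [map_mul, map_one]
      exact congrArg Subtype.val hb
    exact hP.not_isUnit (isUnit_iff_exists_inv.mpr ⟨b, hinj hb'⟩)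
  obtain ⟨B, hAB, hIB⟩ := I.image_subset_nonunits_valuationSubring hI
  have hPB : B.valuation (aeval γ P) < 1 :=
    B.mem_nonunits_iff.mp
      (hIB ⟨⟨aeval γ P, hmem P⟩, Ideal.mem_span_singleton_self _, rfl⟩)
  refine ⟨⟨B, fun c => hAB ?_, ?_⟩, hAB ?_, hPB⟩
  · simpa using hmem (C c)
  · rintro rfl
    have h0 : aeval γ P ≠ 0 := fun h => hP.ne_zero (hinj (by simpa using h))
    have : (⊤ : ValuationSubring K).valuation (aeval γ P)⁻¹ ≤ 1 :=
      (ValuationSubring.valuation_le_one_iff _ _).mpr trivial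
    rw [map_inv₀, inv_le_one₀ (zero_lt_iff.mpr ((Valuation.ne_zero_iff _).mpr h0))] at this
    exact absurd hPB (not_lt.mpr this)
  · simpa using hmem X

/-- Since `z` is algebraic over k[γ], it has a nonzero multiple `z * t` in k[γ] with `t` in k[γ][z],
hence integral at `v`. Polynomial values thus become arbitrarily small, with no appeal to
discreteness of the valuation. -/
theorem exists_valuation_aeval_le {γ z : K} [Algebra.IsAlgebraic (Algebra.adjoin k {γ}) K]
    (hγ : γ ∈ v.valRing) (hz0 : z ≠ 0) (hz : z ∈ v.valRing) :
    ∃ a : k[X], a ≠ 0 ∧ v.valRing.valuation (aeval γ a) ≤ v.valRing.valuation z := by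
  obtain ⟨t, ht, r, hr0, hr⟩ := (Algebra.IsAlgebraic.isAlgebraic (R := Algebra.adjoin k {γ})
    z).exists_nonzero_eq_adjoin_mul (mem_nonZeroDivisors_of_ne_zero hz0)
  obtain ⟨r, hrmem⟩ := r
  have hrmem' := hrmem
  rw [Algebra.adjoin_singleton_eq_range_aeval] at hrmem'
  obtain ⟨a, rfl⟩ := hrmem'
  refine ⟨a, ?_, ?_⟩
  · rintro rfl
    exact hr0 (Subtype.ext (by simp))
  · have hr' : z * t = aeval γ a := hr
    rw [← hr', map_mul]
    refine mul_le_of_le_one_right' ((v.valRing.valuation_le_one_iff _).mpr ?_)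
    obtain ⟨f, rfl⟩ := (Algebra.adjoin_singleton_eq_range_aeval _ _).le ht
    change aeval z f ∈ v.valRing
    rw [aeval_eq_sum_range]
    refine sum_mem fun i _ => ?_
    rw [Algebra.smul_def]
    refine mul_mem ?_ (pow_mem hz _)
    obtain ⟨y, hy⟩ := f.coeff i
    change y ∈ v.valRing
    rw [Algebra.adjoin_singleton_eq_range_aeval] at hy
    obtain ⟨b, rfl⟩ := hy
    exact aeval_mem hγ b

theorem exists_valuation_lt_one (v : FFPlace k K) :
    ∃ z : K, z ≠ 0 ∧ v.valRing.valuation z < 1 := by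
  by_contra! h
  refine v.ne_top (top_unique fun y _ => ?_)
  rcases eq_or_ne y 0 with rfl | hy
  · exact zero_mem _
  rw [← v.valRing.valuation_le_one_iff]
  have := h y⁻¹ (inv_ne_zero hy)
  rwa [map_inv₀, one_le_inv₀ (zero_lt_iff.mpr ((Valuation.ne_zero_iff _).mpr hy))] at this

/-- A polynomial in `γ` of value below 1 divides some γ^i (γ^n - 1) with γ^i a unit at `v`.
Frobenius then removes the `p`-part of `n`. -/
theorem exists_pow_sub_one_valuation_lt_one [Finite k] {p : ℕ} [Fact p.Prime] [CharP k p] {γ : K}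
    [Algebra.IsAlgebraic (Algebra.adjoin k {γ}) K] (hγ : v.valRing.valuation γ = 1) :
    ∃ n : ℕ, ¬ p ∣ n ∧ v.valRing.valuation (γ ^ n - 1) < 1 := by
  have hγm : γ ∈ v.valRing := (v.valRing.valuation_le_one_iff _).mp hγ.le
  obtain ⟨z, hz0, hz⟩ := v.exists_valuation_lt_one
  obtain ⟨a, ha0, ha⟩ := exists_valuation_aeval_le hγm hz0
    ((v.valRing.valuation_le_one_iff _).mp hz.le)
  obtain ⟨i, n, hn, hdvd⟩ := exists_dvd_X_pow_sub_X_pow ha0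
  have h := (valuation_aeval_le_of_dvd hγm hdvd).trans_lt (ha.trans_lt hz)
  simp only [map_mul, map_pow, aeval_X, hγ, one_pow, one_mul, map_sub, map_one] at h
  obtain ⟨e, m, hm, rfl⟩ := Nat.exists_eq_pow_mul_and_not_dvd hn.ne' p
    (Fact.out : p.Prime).ne_one
  refine ⟨m, hm, ?_⟩
  have : CharP K p := charP_of_injective_algebraMap (algebraMap k K).injective p
  rw [mul_comm, pow_mul] at h
  rw [show (γ ^ m) ^ p ^ e - 1 = (γ ^ m - 1) ^ p ^ e by rw [sub_pow_char_pow, one_pow],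
    map_pow] at h
  exact (pow_lt_one_iff (pow_pos (Fact.out : p.Prime).pos e).ne').mp h

/-- The powers of a transcendental unit at `v` tend to `1` along exponents that become
more and more divisible. -/
theorem exists_zpow_sub_one_valuation_lt [Finite k] [Algebra k⟮X⟯ K] [IsScalarTower k k⟮X⟯ K]
    [FunctionField k K] {γ : K} (hγt : Transcendental k γ) (hγ : v.valRing.valuation γ = 1)
    {z : K} (hz : z ≠ 0) :
    ∃ N : ℕ, 0 < N ∧ ∀ n : ℤ, (N : ℤ) ∣ n →
      v.valRing.valuation (γ ^ n - 1) < v.valRing.valuation z := by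
  wlog hzv : z ∈ v.valRing generalizing z
  · obtain ⟨N, hN, h⟩ := this one_ne_zero (one_mem _)
    refine ⟨N, hN, fun n hn => (h n hn).trans ?_⟩
    rw [map_one]
    exact not_le.mp fun h => hzv ((v.valRing.valuation_le_one_iff _).mp h)
  obtain ⟨p, _⟩ := CharP.exists k
  have : Fact p.Prime := ⟨CharP.char_is_prime k p⟩
  have : CharP K p := charP_of_injective_algebraMap (algebraMap k K).injective p
  have := FunctionField.isAlgebraic_adjoin_of_transcendental hγt
  obtain ⟨m, hm, hmv⟩ := exists_pow_sub_one_valuation_lt_one (p := p) hγ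
  have hm0 : 0 < m := Nat.pos_of_ne_zero fun h => hm (h ▸ dvd_zero p)
  have hπt : Transcendental k (γ ^ m - 1) := fun h => hγt <| by
    have : IsAlgebraic k (γ ^ m) := by simpa using h.add isAlgebraic_one
    exact this.of_pow hm0
  set π := γ ^ m - 1 with hπ
  have := FunctionField.isAlgebraic_adjoin_of_transcendental hπt
  have hπv : π ∈ v.valRing := (v.valRing.valuation_le_one_iff _).mp hmv.le
  have hπ0 : 0 < v.valRing.valuation π := by
    rw [zero_lt_iff, Valuation.ne_zero_iff]
    intro h
    rw [h] at hπt
    exact hπt isAlgebraic_zero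
  -- Powers of `π` suffice to get below `z`: writing `a = X ^ r * b` with `X` not dividing `b`, the
  -- factor `b(π)` has value 1.
  obtain ⟨a, ha0, ha⟩ := exists_valuation_aeval_le hπv hz hzv
  obtain ⟨r, b, hb, rfl⟩ := WfDvdMonoid.max_power_factor ha0 (irreducible_X (R := k))
  have hb1 : v.valRing.valuation (aeval π b) = 1 :=
    le_antisymm (valuation_aeval_le_one hπv b)
      (not_lt.mp fun h => hb (dvd_of_valuation_aeval_lt_one hπv irreducible_X (by simpa using hmv) h))
  rw [map_mul, map_mul, hb1, mul_one, map_pow, map_pow, aeval_X] at ha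
  -- By Frobenius γ^(m p^(r+1)) - 1 = π^(p^(r+1)), and `p ^ (r + 1) > r` makes the inequality
  -- strict.
  refine ⟨m * p ^ (r + 1), Nat.mul_pos hm0 (pow_pos (Fact.out : p.Prime).pos _), ?_⟩
  rintro n ⟨b, rfl⟩
  rw [zpow_mul, zpow_natCast]
  refine (Valuation.map_zpow_sub_one_le _ (by rw [map_pow, hγ, one_pow]) b).trans_lt ?_
  rw [pow_mul, show (γ ^ m) ^ p ^ (r + 1) - 1 = π ^ p ^ (r + 1) by
    rw [hπ, sub_pow_char_pow, one_pow], map_pow]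
  refine lt_of_lt_of_le ?_ ha
  refine pow_lt_pow_right_of_lt_one₀ hπ0 hmv ?_
  exact (Nat.lt_succ_self r).trans (Nat.lt_pow_self (Fact.out : p.Prime).one_lt)

end FFPlace

end Places

/-! ### Vanishing coefficient sums and coinciding exponents -/

section Relations

open Polynomial Filter

theorem Ultrafilter.exists_nat_eventually_modEq {A : Type*} (𝓤 : Ultrafilter A) (β : A → ℤ)
    {N : ℕ} (hN : 0 < N) : ∃ r < N, ∀ᶠ a in 𝓤, β a ≡ r [ZMOD N] := by
  have : NeZero N := ⟨hN.ne'⟩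
  obtain ⟨c, hc⟩ := Ultrafilter.eq_pure_of_finite (𝓤.map fun a => (β a : ZMod N))
  have h : ∀ᶠ a in 𝓤, (β a : ZMod N) = c := by
    have : {c} ∈ 𝓤.map fun a => (β a : ZMod N) := by
      rw [hc]
      exact Set.mem_singleton c
    exact this
  refine ⟨c.val, ZMod.val_lt c, h.mono fun a ha => ?_⟩
  rw [← ZMod.intCast_eq_intCast_iff, ha]
  simp

/-- Two integer-valued functions that agree along the ultrafilter `𝓤` modulo every positive
integer, so that they have the same limit in the profinite integers. -/
def SameProfiniteLimit {A : Type*} (𝓤 : Ultrafilter A) (β β' : A → ℤ) : Prop :=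
  ∀ N : ℕ, 0 < N → ∀ᶠ a in 𝓤, β a ≡ β' a [ZMOD N]

variable {k K : Type*} [Field k] [Field K] [Algebra k K]

theorem FFPlace.exists_pow_sub_one_valuation_lt_one_of_finite [Finite k] {p : ℕ} [Fact p.Prime]
    [CharP k p] {γ : K} [Algebra.IsAlgebraic (Algebra.adjoin k {γ}) K] {S : Set (FFPlace k K)}
    (hS : S.Finite) : ∃ n : ℕ, ¬ p ∣ n ∧
      ∀ v ∈ S, v.valRing.valuation γ = 1 → v.valRing.valuation (γ ^ n - 1) < 1 := by
  induction S, hS using Set.Finite.induction_on with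
  | empty => exact ⟨1, (Fact.out : p.Prime).not_dvd_one, by simp⟩
  | @insert v S _ _ ih =>
    obtain ⟨n, hn, h⟩ := ih
    obtain ⟨m, hm, hv⟩ : ∃ m : ℕ, ¬ p ∣ m ∧
        (v.valRing.valuation γ = 1 → v.valRing.valuation (γ ^ m - 1) < 1) := by
      by_cases hv : v.valRing.valuation γ = 1
      · obtain ⟨m, hm, h⟩ := exists_pow_sub_one_valuation_lt_one (p := p) hv
        exact ⟨m, hm, fun _ => h⟩
      · exact ⟨1, (Fact.out : p.Prime).not_dvd_one, fun h => absurd h hv⟩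
    refine ⟨n * m, fun h => ((Fact.out : p.Prime).dvd_mul.mp h).elim hn hm, ?_⟩
    rintro u (rfl | hu) hγ
    · have := Valuation.map_zpow_sub_one_le u.valRing.valuation (u := γ ^ m)
        (by rw [map_pow, hγ, one_pow]) n
      rw [zpow_natCast, ← pow_mul, mul_comm m] at this
      exact this.trans_lt (hv hγ)
    · have := Valuation.map_zpow_sub_one_le u.valRing.valuation (u := γ ^ n)
        (by rw [map_pow, hγ, one_pow]) m
      rw [zpow_natCast, ← pow_mul] at this
      exact this.trans_lt (h u hu hγ)

/-- If the exponential sum `∑ cⱼ γ ^ βⱼ` tends to zero along an ultrafilter at almost all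
places, then the sum of the coefficients of the terms with a given profinite exponent vanishes. -/
theorem sum_coeff_eq_zero_of_tendsto [Finite k] [Algebra k⟮X⟯ K] [IsScalarTower k k⟮X⟯ K]
    [FunctionField k K] {places : Set (FFPlace k K)} (hcofinite : placesᶜ.Finite) {γ : K}
    (hγt : Transcendental k γ) {A J : Type*} (𝓤 : Ultrafilter A) (T : Finset J) (c : J → k)
    (β : J → A → ℤ)
    (hconv : ∀ v ∈ places, ∀ z : K, z ≠ 0 → ∀ᶠ a in 𝓤,
      v.valRing.valuation (∑ j ∈ T, algebraMap k K (c j) * γ ^ β j a) < v.valRing.valuation z)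
    {i : J} [DecidablePred fun j => SameProfiniteLimit 𝓤 (β j) (β i)] :
    ∑ j ∈ T with SameProfiniteLimit 𝓤 (β j) (β i), c j = 0 := by
  obtain ⟨p, _⟩ := CharP.exists k
  have hp : p.Prime := CharP.char_is_prime k p
  have : Fact p.Prime := ⟨hp⟩
  have : CharP K p := charP_of_injective_algebraMap (algebraMap k K).injective p
  have := FunctionField.isAlgebraic_adjoin_of_transcendental hγt
  have hinj := transcendental_iff_injective.mp hγt
  have hγ0 : γ ≠ 0 := fun h => by
    rw [h] at hγt
    exact hγt isAlgebraic_zero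
  -- a modulus that separates the exponents with different limits from that of `i`
  have hsep : ∀ j : J, ∃ n : ℕ, 0 < n ∧ (¬ SameProfiniteLimit 𝓤 (β j) (β i) →
      ∀ᶠ a in 𝓤, ¬ β j a ≡ β i a [ZMOD n]) := by
    intro j
    by_cases h : SameProfiniteLimit 𝓤 (β j) (β i)
    · exact ⟨1, one_pos, fun h' => absurd h h'⟩
    · have h' := h
      simp only [SameProfiniteLimit, not_forall] at h'
      obtain ⟨n, hn, h'⟩ := h'
      exact ⟨n, hn, fun _ => Ultrafilter.eventually_not.mpr h'⟩
  choose n hn hnsep using hsep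
  obtain ⟨s, m, hm, hsm⟩ := Nat.exists_eq_pow_mul_and_not_dvd
    (Finset.prod_pos (s := T) fun j _ => hn j).ne' p hp.ne_one
  -- `N₀` takes care of the finitely many places without convergence: wherever `γ` is a unit among
  -- them, γ^N₀ reduces to 1.
  obtain ⟨N₀, hN₀, hN₀S⟩ :=
    FFPlace.exists_pow_sub_one_valuation_lt_one_of_finite (p := p) (γ := γ) hcofinite
  have hpos : ∀ {m : ℕ}, ¬ p ∣ m → 0 < m := fun {m} h =>
    Nat.pos_of_ne_zero fun h0 => h (h0 ▸ dvd_zero p)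
  -- A multiple of `m` that is prime to `p` and exceeds the number of terms; with `p ^ s` it makes
  -- every separating modulus divide `N`.
  let N₁ := m * (p * T.card + 1)
  have hN₁ : ¬ p ∣ N₁ := fun h => (hp.dvd_mul.mp h).elim hm fun h' =>
    hp.not_dvd_one ((Nat.dvd_add_right (dvd_mul_right p _)).mp h')
  have hTN₁ : T.card < N₁ := by
    have h1 : T.card ≤ p * T.card := Nat.le_mul_of_pos_left _ hp.pos
    have h2 : p * T.card + 1 ≤ N₁ := Nat.le_mul_of_pos_left _ (hpos hm)
    omega
  let N := N₀ * p ^ s * N₁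
  have hN : 0 < N := Nat.mul_pos (Nat.mul_pos (hpos hN₀) (pow_pos hp.pos s)) (hpos hN₁)
  choose r hrlt hr using fun j => 𝓤.exists_nat_eventually_modEq (β j) hN
  have hclass : ∀ j ∈ T, r j = r i ↔ SameProfiniteLimit 𝓤 (β j) (β i) := by
    intro j hj
    constructor
    · intro hji
      by_contra hne
      obtain ⟨a, h1, h2, h3⟩ := ((hr j).and ((hr i).and (hnsep j hne))).exists
      refine h3 (Int.ModEq.of_dvd ?_ (h1.trans (hji ▸ h2.symm)))
      have hdvd : n j ∣ p ^ s * m := hsm ▸ Finset.dvd_prod_of_mem n hj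
      refine Int.natCast_dvd_natCast.mpr (hdvd.trans ⟨N₀ * (p * T.card + 1), ?_⟩)
      simp only [N, N₁]
      ring
    · intro hji
      obtain ⟨a, h1, h2, h3⟩ := ((hr j).and ((hr i).and (hji N hN))).exists
      have h4 : (r j : ℤ) ≡ r i [ZMOD N] := h1.symm.trans (h3.trans h2)
      exact Nat.ModEq.eq_of_lt_of_lt (Int.natCast_modEq_iff.mp h4) (hrlt j) (hrlt i)
  -- The exponential sum with exponents reduced modulo `N`; its coefficient at `r i` is the sum to
  -- be shown zero.
  let g : k[X] := ∑ j ∈ T, C (c j) * X ^ r j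
  have hgN : g.natDegree < N := by
    refine lt_of_le_of_lt (natDegree_sum_le_of_forall_le T _ (n := N - 1) fun j _ => ?_) (by omega)
    exact (natDegree_C_mul_X_pow_le _ _).trans (by have := hrlt j; omega)
  have hgsupp : g.support.card < N₁ := by
    refine lt_of_le_of_lt (le_trans (Finset.card_le_card (t := T.image r) ?_)
      Finset.card_image_le) hTN₁
    intro e he
    by_contra hne
    refine mem_support_iff.mp he ?_
    rw [finsetSum_coeff]
    refine Finset.sum_eq_zero fun j hj => ?_
    rw [coeff_C_mul_X_pow, if_neg]
    rintro rfl
    exact hne (Finset.mem_image_of_mem r hj)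
  have hg : g = 0 := by
    refine eq_zero_of_forall_irreducible_pow_dvd hN₀ hN₁ hgN hgsupp fun P hP hPN hPN₀ => ?_
    obtain ⟨v, hγv, hPv⟩ := FFPlace.exists_place_of_irreducible hγt hP
    have hPN' := FFPlace.valuation_aeval_le_of_dvd hγv hPN
    simp only [map_sub, map_pow, aeval_X, map_one] at hPN'
    have hγ1 : v.valRing.valuation γ = 1 := by
      have h1 : v.valRing.valuation (γ ^ (N₀ * N₁)) = 1 := by
        have := Valuation.map_add_eq_of_lt_right v.valRing.valuation
          (x := γ ^ (N₀ * N₁) - 1) (y := 1) (by rw [map_one]; exact hPN'.trans_lt hPv)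
        rwa [sub_add_cancel, map_one] at this
      rw [map_pow] at h1
      exact (pow_eq_one_iff.mp h1).resolve_right (Nat.mul_pos (hpos hN₀) (hpos hN₁)).ne'
    -- At an exceptional place `P` would divide `X ^ N₀ - 1`, which is excluded.
    have hv : v ∈ places := by
      by_contra hv
      refine hPN₀ (FFPlace.dvd_of_valuation_aeval_lt_one hγv hP hPv ?_)
      simpa using hN₀S v hv hγ1
    refine FFPlace.pow_dvd_of_valuation_aeval_le hγv hγt hP hPv ?_
    have hP0 : aeval γ P ^ p ^ s ≠ 0 :=
      pow_ne_zero _ fun h => hP.ne_zero (hinj (by simpa using h))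
    obtain ⟨a, ha, har⟩ := ((hconv v hv _ hP0).and
      ((Finset.eventually_all T).mpr fun j _ => hr j)).exists
    rw [map_pow] at ha
    -- Reducing the exponents modulo `N` costs at most the value of γ^N - 1 = (γ^(N₀N₁) - 1)^(p^s),
    -- which is at most that of P(γ)^(p^s). The original sum is that small by convergence.
    have hgγ : aeval γ g = ∑ j ∈ T, algebraMap k K (c j) * γ ^ β j a -
        ∑ j ∈ T, algebraMap k K (c j) * γ ^ r j * (γ ^ (β j a - r j) - 1) := by
      simp only [g, map_sum, map_mul, aeval_C, map_pow, aeval_X]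
      rw [← Finset.sum_sub_distrib]
      refine Finset.sum_congr rfl fun j _ => ?_
      rw [zpow_sub₀ hγ0, zpow_natCast]
      field_simp
      ring
    rw [hgγ]
    refine Valuation.map_sub_le _ ha.le (Valuation.map_sum_le _ fun j hj => ?_)
    rw [map_mul, map_mul, map_pow, hγ1, one_pow, mul_one]
    refine (mul_le_of_le_one_left' (v.valuation_algebraMap_le_one _)).trans ?_
    obtain ⟨b, hb⟩ := (har j hj).symm.dvd
    rw [hb, zpow_mul, zpow_natCast]
    refine (Valuation.map_zpow_sub_one_le _ (by rw [map_pow, hγ1, one_pow]) b).trans ?_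
    have hNeq : γ ^ N - 1 = (γ ^ (N₀ * N₁) - 1) ^ p ^ s := by
      rw [sub_pow_char_pow, one_pow, ← pow_mul]
      congr 2
      simp only [N]
      ring
    rw [hNeq, map_pow]
    exact pow_le_pow_left' hPN' _
  have hcoeff := congrArg (fun f : k[X] => f.coeff (r i)) hg
  simp only [g, finsetSum_coeff, coeff_C_mul_X_pow, coeff_zero] at hcoeff
  rw [Finset.sum_filter]
  refine (Finset.sum_congr rfl fun j hj => ?_).trans hcoeff
  by_cases h : SameProfiniteLimit 𝓤 (β j) (β i)
  · rw [if_pos h, if_pos ((hclass j hj).mpr h).symm]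
  · rw [if_neg h, if_neg fun h' => h ((hclass j hj).mp h'.symm)]

/-- Among the tuples in the residue classes met by the ultrafilter there are tuples at which
finitely many affine forms with equal profinite limits take equal values. -/
theorem exists_int_point_of_sameProfiniteLimit {M : ℕ} (𝓤 : Ultrafilter (Fin M → ℤ))
    {U : Set (Fin M → ℤ)} (hU : U ∈ 𝓤) {N : ℕ} (hN : 0 < N) (T : Finset (ℤ × (Fin M → ℤ))) :
    ∃ a ∈ U, ∃ y : Fin M → ℤ, ∀ i ∈ T, ∀ j ∈ T,
      SameProfiniteLimit 𝓤 (fun a => i.1 + i.2 ⬝ᵥ a) (fun a => j.1 + j.2 ⬝ᵥ a) →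
      i.1 + i.2 ⬝ᵥ (a + N • y) = j.1 + j.2 ⬝ᵥ (a + N • y) := by
  -- One linear equation for each pair of forms with equal limits; the ultrafilter supplies
  -- solutions modulo every `n` in a fixed class modulo `N`.
  let H := {q : T × T // SameProfiniteLimit 𝓤 (fun a => q.1.1.1 + q.1.1.2 ⬝ᵥ a)
    (fun a => q.2.1.1 + q.2.1.2 ⬝ᵥ a)}
  have : Finite H := Subtype.finite
  let L : (Fin M → ℤ) →+ (H → ℤ) :=
    AddMonoidHom.mk' (fun a q => q.1.1.1.2 ⬝ᵥ a - q.1.2.1.2 ⬝ᵥ a) fun a b => by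
      funext q
      simp only [dotProduct_add, Pi.add_apply]
      ring
  let b : H → ℤ := fun q => q.1.2.1.1 - q.1.1.1.1
  have hres : ∀ l : Fin M, ∃ r : ℕ, ∀ᶠ a : Fin M → ℤ in 𝓤, a l ≡ r [ZMOD N] := fun l => by
    obtain ⟨r, -, h⟩ := 𝓤.exists_nat_eventually_modEq (fun a => a l) hN
    exact ⟨r, h⟩
  choose r hr using hres
  have hr' : ∀ᶠ a : Fin M → ℤ in 𝓤, ∀ l, a l ≡ r l [ZMOD N] := eventually_all.mpr hr
  obtain ⟨a₀, ha₀U, ha₀⟩ : ∃ a ∈ U, ∀ l, a l ≡ r l [ZMOD N] :=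
    (hr'.and hU).exists.imp fun a h => ⟨h.2, h.1⟩
  obtain ⟨y, hy⟩ := exists_int_solution_of_forall_mod L b a₀ N fun n hn => by
    have hq : ∀ᶠ a in 𝓤, ∀ q : H, q.1.1.1.1 + q.1.1.1.2 ⬝ᵥ a ≡
        q.1.2.1.1 + q.1.2.1.2 ⬝ᵥ a [ZMOD n] := eventually_all.mpr fun q => q.2 n hn
    obtain ⟨a, ha, haq⟩ := (hr'.and hq).exists
    choose y hy using fun l => ((ha₀ l).trans (ha l).symm).dvd
    choose z hz using fun q => (haq q).symm.dvd
    refine ⟨a, y, z, ?_, ?_⟩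
    · funext l
      have := hy l
      rw [Pi.add_apply, Pi.smul_apply, nsmul_eq_mul]
      linarith
    · funext q
      have := hz q
      rw [Pi.add_apply, Pi.smul_apply, nsmul_eq_mul]
      simp only [L, b, AddMonoidHom.mk'_apply]
      linarith
  refine ⟨a₀, ha₀U, y, fun i hi j hj hij => ?_⟩
  have := congrFun hy ⟨(⟨i, hi⟩, ⟨j, hj⟩), hij⟩
  simp only [L, b, AddMonoidHom.mk'_apply] at this
  linarith

end Relations

/-! ### Rewriting equations over k(Γ) as exponential sums over k -/

section MonomialForms

open MvPolynomial IntermediateField.algebraAdjoinAdjoin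

variable {k K : Type*} [Field k] [Field K] [Algebra k K] {Γ : Subgroup Kˣ} {M : ℕ}

theorem fieldGen.monomial_mem_span {g : Kˣ} (hg : ∀ u ∈ Γ, ∃ e : ℤ, g ^ e = u)
    {γ : fieldGen k Γ} (hγ : (γ : K) = g) {x : K}
    (hx : x ∈ Algebra.adjoin k ((fun u : Kˣ => (u : K)) '' (Γ : Set Kˣ))) :
    ∃ y : fieldGen k Γ, (y : K) = x ∧ ∀ m : Fin M →₀ ℕ, monomial m y ∈
      Submodule.span k (Set.range fun j : ℤ × (Fin M →₀ ℕ) => monomial j.2 (γ ^ j.1)) := by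
  replace hx : x ∈ Submodule.span k (Submonoid.closure
      ((fun u : Kˣ => (u : K)) '' (Γ : Set Kˣ)) : Set K) := by
    rw [← Algebra.adjoin_eq_span]
    exact hx
  induction hx using Submodule.span_induction with
  | mem x hx =>
    obtain ⟨e, rfl⟩ : ∃ e : ℤ, (g : K) ^ e = x := by
      induction hx using Submonoid.closure_induction with
      | mem x hx =>
        obtain ⟨u, hu, rfl⟩ := hx
        obtain ⟨e, rfl⟩ := hg u hu
        exact ⟨e, (Units.val_zpow_eq_zpow_val g e).symm⟩
      | one => exact ⟨0, zpow_zero _⟩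
      | mul x y _ _ hx hy =>
        obtain ⟨e, rfl⟩ := hx
        obtain ⟨e', rfl⟩ := hy
        exact ⟨e + e', zpow_add₀ g.ne_zero e e'⟩
    refine ⟨γ ^ e, ?_, fun m => Submodule.subset_span ⟨(e, m), rfl⟩⟩
    rw [← hγ]
    exact map_zpow₀ (algebraMap (fieldGen k Γ) K) γ e
  | zero => exact ⟨0, rfl, fun m => by simp⟩
  | add x y _ _ hx hy =>
    obtain ⟨x, rfl, hx⟩ := hx
    obtain ⟨y, rfl, hy⟩ := hy
    exact ⟨x + y, rfl, fun m => by rw [map_add]; exact add_mem (hx m) (hy m)⟩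
  | smul c x _ hx =>
    obtain ⟨x, rfl, hx⟩ := hx
    refine ⟨c • x, rfl, fun m => ?_⟩
    rw [← smul_monomial]
    exact Submodule.smul_mem _ c (hx m)

/-- A polynomial over `k(Γ)`, where `Γ` is generated by `g`, is up to a nonzero constant a
`k`-linear combination of monomials whose coefficients are powers of `g`. -/
theorem fieldGen.exists_C_mul_eq_sum {g : Kˣ} (hg : ∀ u ∈ Γ, ∃ e : ℤ, g ^ e = u)
    {γ : fieldGen k Γ} (hγ : (γ : K) = g) (f : MvPolynomial (Fin M) (fieldGen k Γ)) :
    ∃ d : fieldGen k Γ, d ≠ 0 ∧ ∃ h : (ℤ × (Fin M →₀ ℕ)) →₀ k,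
      C d * f = ∑ j ∈ h.support, h j • monomial j.2 (γ ^ j.1) := by
  classical
  -- k(Γ) is the fraction field of k[Γ], and k[Γ] is spanned over k by the powers of `g`; `d` is a
  -- common denominator of the coefficients.
  obtain ⟨⟨d, hd⟩, hdf⟩ := IsLocalization.exist_integer_multiples_of_finset
    (nonZeroDivisors (Algebra.adjoin k ((fun u : Kˣ => (u : K)) '' (Γ : Set Kˣ))))
    (f.support.image fun m => f.coeff m)
  refine ⟨algebraMap _ (fieldGen k Γ) d, ?_, ?_⟩
  · rw [Ne, FaithfulSMul.algebraMap_eq_zero_iff]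
    exact nonZeroDivisors.ne_zero hd
  have hmem : C (algebraMap _ (fieldGen k Γ) d) * f ∈
      Submodule.span k (Set.range fun j : ℤ × (Fin M →₀ ℕ) => monomial j.2 (γ ^ j.1)) := by
    nth_rewrite 1 [f.as_sum]
    rw [Finset.mul_sum]
    refine sum_mem fun m hm => ?_
    obtain ⟨x, hx⟩ := hdf _ (Finset.mem_image_of_mem _ hm)
    obtain ⟨y, hy, hspan⟩ := fieldGen.monomial_mem_span (M := M) hg hγ x.2
    rw [C_mul_monomial, ← Algebra.smul_def]
    have : (d • f.coeff m : fieldGen k Γ) = y := by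
      refine hx.symm.trans (Subtype.ext ?_)
      rw [hy]
      rfl
    rw [this]
    exact hspan m
  obtain ⟨h, hh⟩ := (Finsupp.mem_span_range_iff_exists_finsupp).mp hmem
  exact ⟨h, hh.symm⟩

/-- The polynomial equation `f = 0` as an equation between terms `c γ ^ e x ^ m`. -/
theorem fieldGen.exists_eval₂_eq_zero_iff {g : Kˣ} (hgΓ : g ∈ Γ)
    (hg : ∀ u ∈ Γ, ∃ e : ℤ, g ^ e = u) (f : MvPolynomial (Fin M) (fieldGen k Γ)) :
    ∃ h : (ℤ × (Fin M →₀ ℕ)) →₀ k, ∀ {R : Type _} [CommRing R] (φ : K →+* R) (x : Fin M → R),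
      eval₂ (φ.comp (algebraMap (fieldGen k Γ) K)) x f = 0 ↔
        ∑ j ∈ h.support, φ (algebraMap k K (h j) * (g : K) ^ j.1) * ∏ i, x i ^ j.2 i = 0 := by
  let γ : fieldGen k Γ := ⟨g, IntermediateField.subset_adjoin k _ ⟨g, hgΓ, rfl⟩⟩
  obtain ⟨d, hd, h, hh⟩ := fieldGen.exists_C_mul_eq_sum hg (γ := γ) rfl f
  refine ⟨h, fun {R} _ φ x => ?_⟩
  -- `R` may have zero divisors, as a product of completions does; `d` can be cancelled because it
  -- is a unit already in k(Γ).
  have hu : IsUnit ((φ.comp (algebraMap (fieldGen k Γ) K)) d) := (isUnit_iff_ne_zero.mpr hd).map _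
  rw [← hu.mul_right_eq_zero, ← eval₂_C (φ.comp (algebraMap (fieldGen k Γ) K)) x d,
    ← eval₂_mul, hh, eval₂_sum]
  refine Eq.congr_left (Finset.sum_congr rfl fun j _ => ?_)
  rw [smul_monomial, eval₂_monomial, Algebra.smul_def, Finsupp.prod_fintype _ _ fun _ => pow_zero _]
  congr 1

end MonomialForms

/-! ### Convergence in a completion, expressed by the valuation on K -/

section Topology

open Filter Topology

namespace FFPlace

variable {k K : Type*} [Field k] [Field K] [Algebra k K]

theorem tendsto_embed_zero_iff (v : FFPlace k K) {A : Type*} {𝓕 : Filter A} {u : A → K} :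
    Tendsto (fun a => v.embed (u a)) 𝓕 (𝓝 0) ↔
      ∀ z : K, z ≠ 0 → ∀ᶠ a in 𝓕, v.valRing.valuation (u a) < v.valRing.valuation z := by
  have hind : IsInducing ((↑) : WithVal v.valRing.valuation → v.Completion) :=
    (UniformSpace.Completion.isUniformInducing_coe _).isInducing
  have h1 : Tendsto (fun a => v.embed (u a)) 𝓕 (𝓝 0) ↔
      Tendsto (fun a => WithVal.toVal v.valRing.valuation (u a)) 𝓕 (𝓝 0) := by
    rw [hind.tendsto_nhds_iff, UniformSpace.Completion.coe_zero]
    rfl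
  rw [h1]
  constructor
  · intro h z hz
    have hmem : {y : WithVal v.valRing.valuation | Valued.v y < v.valRing.valuation z} ∈ 𝓝 0 := by
      refine (Valued.mem_nhds_zero).mpr ⟨Units.mk0 (Valued.v.restrict
        (WithVal.toVal v.valRing.valuation z)) ?_, fun y hy => ?_⟩
      · simpa using hz
      · exact (Valuation.restrict_lt_iff _).mp hy
    exact h.eventually hmem
  · intro h s hs
    obtain ⟨γ, hγ⟩ := Valued.mem_nhds_zero.mp hs
    obtain ⟨z, hz⟩ := v.valRing.valuation_surjective (MonoidWithZeroHom.ValueGroup₀.embedding γ.1)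
    have hz0 : z ≠ 0 := by
      rintro rfl
      rw [map_zero] at hz
      exact γ.ne_zero (by simpa using hz.symm)
    rw [mem_map]
    filter_upwards [h z hz0] with a ha
    refine hγ ((Valuation.restrict_lt_iff_lt_embedding _).mpr ?_)
    rw [← hz]
    exact ha

end FFPlace

end Topology

/-! ### Approximation by points of W(Γ) -/

section MainTheorem

open Filter Topology FFPlace

variable {k K : Type*} [Field k] [Field K] [Algebra k K]

theorem Subgroup.exists_generator_of_finrank_eq_one {G : Type*} [CommGroup G] {Γ : Subgroup G}
    (hfree : Module.Free ℤ (Additive Γ)) (hrank : Module.finrank ℤ (Additive Γ) = 1) :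
    ∃ g ∈ Γ, (∀ u ∈ Γ, ∃ e : ℤ, g ^ e = u) ∧ ∀ n : ℕ, 0 < n → g ^ n ≠ 1 := by
  obtain ⟨g, hg0, hg⟩ := finrank_eq_one_iff'.mp hrank
  refine ⟨g.toMul, g.toMul.2, fun u hu => ?_, fun n hn h => ?_⟩
  · obtain ⟨e, he⟩ := hg (Additive.ofMul ⟨u, hu⟩)
    exact ⟨e, congrArg (fun y : Additive Γ => (y.toMul : G)) he⟩
  · have : (n : ℤ) • g = 0 := by
      rw [natCast_zsmul]
      exact Additive.toMul.injective (Subtype.ext h)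
    rcases smul_eq_zero.mp this with h | h
    · omega
    · exact hg0 h

theorem FFPlace.valuation_eq_one_of_mem_sUnits {S : Set (FFPlace k K)} {u : Kˣ}
    (hu : u ∈ sUnits S) {v : FFPlace k K} (hv : v ∉ S) : v.valRing.valuation (u : K) = 1 := by
  have hle : ∀ x ∈ sIntegers S, v.valRing.valuation x ≤ 1 := fun x hx => by
    rw [ValuationSubring.valuation_le_one_iff]
    simp only [sIntegers, Subring.mem_iInf] at hx
    exact hx v hv
  obtain ⟨h1, h2⟩ := (Submonoid.mem_units_iff _ _).mp hu
  refine le_antisymm (hle _ h1) ?_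
  have h3 := hle _ h2
  rw [Units.val_inv_eq_inv_val, map_inv₀] at h3
  exact (inv_le_one₀ (zero_lt_iff.mpr ((Valuation.ne_zero_iff _).mpr u.ne_zero))).mp h3

theorem exists_nhds_mul_nhds_one_subset {G : Type*} [TopologicalSpace G] [Monoid G]
    [ContinuousMul G] {x : G} {U : Set G} (hU : U ∈ 𝓝 x) :
    ∃ U₁ ∈ 𝓝 x, ∃ V ∈ 𝓝 (1 : G), ∀ u ∈ U₁, ∀ w ∈ V, u * w ∈ U := by
  have h := (continuous_mul (M := G)).tendsto (x, 1)
  rw [nhds_prod_eq, mul_one] at h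
  obtain ⟨U₁, hU₁, V, hV, hUV⟩ := mem_prod_iff.mp (h hU)
  exact ⟨U₁, hU₁, V, hV, fun u hu w hw => hUV (Set.mk_mem_prod hu hw)⟩

/-- The tuple of powers of `g` with given exponents, embedded diagonally. -/
noncomputable def FFPlace.powTuple {M : ℕ} (T : Set (FFPlace k K)) (g : Kˣ) (a : Fin M → ℤ) :
    Fin M → ProdUnits T :=
  fun i => diagUnits T (g ^ a i)

theorem FFPlace.powTuple_add {M : ℕ} (T : Set (FFPlace k K)) (g : Kˣ) (a b : Fin M → ℤ) :
    powTuple T g (a + b) = powTuple T g a * powTuple T g b := by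
  funext i
  simp only [powTuple, Pi.add_apply, zpow_add, map_mul, Pi.mul_apply]

theorem FFPlace.exists_powTuple_nsmul_mem [Finite k] [Algebra k⟮X⟯ K] [IsScalarTower k k⟮X⟯ K]
    [FunctionField k K] {M : ℕ} {T : Set (FFPlace k K)} {g : Kˣ}
    (hgt : Transcendental k (g : K)) (hg : ∀ v ∈ T, v.valRing.valuation (g : K) = 1)
    {V : Set (Fin M → ProdUnits T)} (hV : V ∈ 𝓝 1) :
    ∃ N : ℕ, 0 < N ∧ ∀ y : Fin M → ℤ, powTuple T g (N • y) ∈ V := by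
  by_contra! hcon
  -- Factorials are eventually divisible by the modulus needed at each single place, which suffices
  -- in the product topology.
  choose y hy using fun n : ℕ => hcon n.factorial n.factorial_pos
  have hlim : Tendsto (fun n : ℕ => powTuple T g (n.factorial • y n)) atTop (𝓝 1) := by
    refine tendsto_pi_nhds.mpr fun i => tendsto_pi_nhds.mpr fun v => ?_
    rw [Units.isEmbedding_val₀.isInducing.tendsto_nhds_iff, ← tendsto_sub_nhds_zero_iff]
    have := (v : FFPlace k K).tendsto_embed_zero_iff (𝓕 := atTop)
      (u := fun n : ℕ => (g : K) ^ (n.factorial • y n) i - 1)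
    refine Tendsto.congr (fun n => ?_) (this.mpr fun z hz => ?_)
    · rw [map_sub, map_one]
      simp only [powTuple, Function.comp_apply, Pi.one_apply, Units.val_one, diagUnits,
        MonoidHom.pi_apply, Units.coe_map, Units.val_zpow_eq_zpow_val]
      rfl
    · obtain ⟨N, hN, h⟩ := exists_zpow_sub_one_valuation_lt hgt (hg v v.2) hz
      filter_upwards [eventually_ge_atTop N] with n hn
      refine h _ ?_
      rw [Pi.smul_apply, nsmul_eq_mul]
      exact (Int.natCast_dvd_natCast.mpr (Nat.dvd_factorial hN hn)).mul_right _
  obtain ⟨n, hn⟩ := (hlim.eventually hV).exists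
  exact hy n hn

theorem prod_zpow_pow_eq_zpow_dotProduct {M : ℕ} {g : K} (hg : g ≠ 0) (a : Fin M → ℤ)
    (m : Fin M → ℕ) : ∏ i, (g ^ a i) ^ m i = g ^ ((fun i => (m i : ℤ)) ⬝ᵥ a) := by
  have h : ∀ s : Finset (Fin M), ∏ i ∈ s, (g ^ a i) ^ m i = g ^ ∑ i ∈ s, (m i : ℤ) * a i := by
    intro s
    induction s using Finset.cons_induction with
    | empty => simp
    | cons i s hi ih =>
      rw [Finset.prod_cons, Finset.sum_cons, zpow_add₀ hg, ih, mul_comm (m i : ℤ), zpow_mul,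
        zpow_natCast]
  exact h Finset.univ

/-- The equivalence relation on affine forms given by equality of profinite limits. -/
def SameProfiniteLimit.setoid {A J : Type*} (𝓤 : Ultrafilter A) (β : J → A → ℤ) : Setoid J where
  r i j := SameProfiniteLimit 𝓤 (β i) (β j)
  iseqv :=
    { refl := fun _ _ _ => Eventually.of_forall fun _ => rfl
      symm := fun h N hN => (h N hN).mono fun _ => Int.ModEq.symm
      trans := fun h h' N hN => (h N hN).mp ((h' N hN).mono fun _ h2 h1 => h1.trans h2) }

/-- If finitely many exponential sums tend to zero along an ultrafilter at almost all places, then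
they have a common zero in the residue classes met by the ultrafilter. -/
theorem exists_common_zero_of_tendsto [Finite k] [Algebra k⟮X⟯ K] [IsScalarTower k k⟮X⟯ K]
    [FunctionField k K] {places : Set (FFPlace k K)} (hcofinite : placesᶜ.Finite) {g : K}
    (hgt : Transcendental k g) {M : ℕ} (𝓤 : Ultrafilter (Fin M → ℤ)) {U : Set (Fin M → ℤ)}
    (hU : U ∈ 𝓤) {N : ℕ} (hN : 0 < N) {I : Type*} (s : Finset I)
    (h : I → (ℤ × (Fin M →₀ ℕ)) →₀ k)
    (hconv : ∀ f ∈ s, ∀ v ∈ places, ∀ z : K, z ≠ 0 → ∀ᶠ a in 𝓤, v.valRing.valuation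
      (∑ j ∈ (h f).support, algebraMap k K (h f j) * g ^ (j.1 + (fun i => (j.2 i : ℤ)) ⬝ᵥ a)) <
        v.valRing.valuation z) :
    ∃ a ∈ U, ∃ y : Fin M → ℤ, ∀ f ∈ s, ∑ j ∈ (h f).support,
      algebraMap k K (h f j) * g ^ (j.1 + (fun i => (j.2 i : ℤ)) ⬝ᵥ (a + N • y)) = 0 := by
  classical
  let β : ℤ × (Fin M →₀ ℕ) → (Fin M → ℤ) → ℤ := fun j a => j.1 + (fun i => (j.2 i : ℤ)) ⬝ᵥ a
  let ι : ℤ × (Fin M →₀ ℕ) → ℤ × (Fin M → ℤ) := fun j => (j.1, fun i => (j.2 i : ℤ))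
  obtain ⟨a, ha, y, hay⟩ := exists_int_point_of_sameProfiniteLimit 𝓤 hU hN
    ((s.biUnion fun f => (h f).support).image ι)
  refine ⟨a, ha, y, fun f hf => ?_⟩
  -- Within a class the powers of `g` coincide at the chosen point and the coefficients sum to zero.
  refine Finset.sum_cancels_of_partition_cancels (SameProfiniteLimit.setoid 𝓤 β) fun i hi => ?_
  have hclass : ∑ j ∈ (h f).support with SameProfiniteLimit 𝓤 (β j) (β i), h f j = 0 :=
    sum_coeff_eq_zero_of_tendsto hcofinite hgt 𝓤 _ _ β (hconv f hf)
  have hmemT : ∀ l ∈ (h f).support, ι l ∈ (s.biUnion fun f => (h f).support).image ι :=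
    fun l hl => Finset.mem_image_of_mem _ (Finset.mem_biUnion.mpr ⟨f, hf, hl⟩)
  have hval : ∀ j ∈ (h f).support.filter (fun j => SameProfiniteLimit 𝓤 (β j) (β i)),
      algebraMap k K (h f j) * g ^ β j (a + N • y) =
        algebraMap k K (h f j) * g ^ β i (a + N • y) := by
    intro j hj
    obtain ⟨hj, hji⟩ := Finset.mem_filter.mp hj
    have : β j (a + N • y) = β i (a + N • y) := hay _ (hmemT j hj) _ (hmemT i hi) hji
    rw [this]
  refine Eq.trans (Finset.sum_congr ?_ hval) ?_
  · exact Finset.filter_congr fun j _ => Iff.rfl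
  · rw [← Finset.sum_mul, ← map_sum, hclass, map_zero, zero_mul]

namespace ClosedVariety

theorem hasPoint_of_span_eq {F : IntermediateField k K} {M : ℕ}
    {s : Set (MvPolynomial (Fin M) F)} {R : Type*} [CommRing R] {φ : K →+* R} {x : Fin M → R}
    (h : ∀ f ∈ s, MvPolynomial.eval₂ (φ.comp (algebraMap F K)) x f = 0) :
    HasPoint (Ideal.span s) φ x := by
  have : Ideal.span s ≤ RingHom.ker (MvPolynomial.eval₂Hom (φ.comp (algebraMap F K)) x) :=
    Ideal.span_le.mpr fun f hf => h f hf
  exact fun f hf => this hf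

/-- The right side contains the diagonal image of W(Γ), and it is closed because polynomials define
continuous maps. -/
theorem closurePoints_subset_adelicPoints {F : IntermediateField k K} {M : ℕ}
    (W : Ideal (MvPolynomial (Fin M) F)) (Γ : Subgroup Kˣ) (T : Set (FFPlace k K)) :
    closurePoints W Γ T ⊆ adelicPoints W (closureGroup Γ T) := by
  refine closure_minimal ?_ ?_
  · rintro _ ⟨x, ⟨hxΓ, hx⟩, rfl⟩
    refine ⟨fun i => subset_closure ⟨x i, hxΓ i, rfl⟩, fun f hf => ?_⟩
    have := congrArg (diag T) (hx f hf)
    rw [MvPolynomial.hom_eval₂, map_zero] at this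
    exact this
  · have hset : adelicPoints W (closureGroup Γ T) =
        (⋂ i, {x | x i ∈ closureGroup Γ T}) ∩ ⋂ f ∈ W, {x : Fin M → ProdUnits T |
          MvPolynomial.eval₂ ((diag T).comp (algebraMap F K)) (fun i => (x i).toProd) f = 0} := by
      ext x
      simp [adelicPoints, HasPoint]
    rw [hset]
    refine (isClosed_iInter fun i => isClosed_closure.preimage (continuous_apply i)).inter
      (isClosed_biInter fun f _ => isClosed_eq ?_ continuous_const)
    simp only [MvPolynomial.eval₂_eq]
    refine continuous_finsetSum _ fun d _ => continuous_const.mul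
      (continuous_finsetProd _ fun i _ => Continuous.pow ?_ _)
    exact continuous_pi fun v =>
      Units.continuous_val.comp ((continuous_apply v).comp (continuous_apply i))

theorem adelicPoints_subset_closurePoints [Finite k] [Algebra k⟮X⟯ K] [IsScalarTower k k⟮X⟯ K]
    [FunctionField k K] {places : Set (FFPlace k K)} (hcofinite : placesᶜ.Finite)
    {Γ : Subgroup Kˣ} {g : Kˣ} (hgΓ : g ∈ Γ) (hgen : ∀ u ∈ Γ, ∃ e : ℤ, g ^ e = u)
    (hgt : Transcendental k (g : K)) (hg : ∀ v ∈ places, v.valRing.valuation (g : K) = 1)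
    {M : ℕ} (W : Ideal (MvPolynomial (Fin M) (fieldGen k Γ))) :
    adelicPoints W (closureGroup Γ places) ⊆ closurePoints W Γ places := by
  classical
  rintro x ⟨hxΓ, hxW⟩
  obtain ⟨s, rfl⟩ : W.FG := IsNoetherian.noetherian W
  choose h hh using fun f => fieldGen.exists_eval₂_eq_zero_iff (M := M) (k := k) hgΓ hgen f
  have hmem : x ∈ closure (Set.range (powTuple (M := M) places g)) := by
    have : x ∈ closure (Set.univ.pi fun _ : Fin M => diagUnits places '' (Γ : Set Kˣ)) := by
      rw [closure_pi_set]
      exact fun i _ => hxΓ i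
    refine closure_mono (fun y hy => ?_) this
    choose u hu huy using fun i => hy i (Set.mem_univ i)
    choose a ha using fun i => hgen (u i) (hu i)
    refine ⟨a, funext fun i => ?_⟩
    rw [powTuple, ha, huy]
  have hne : (comap (powTuple (M := M) places g) (𝓝 x)).NeBot := comap_neBot fun t ht => by
    obtain ⟨_, hyt, a, rfl⟩ := mem_closure_iff_nhds.mp hmem t ht
    exact ⟨a, hyt⟩
  -- An ultrafilter of exponents along which the tuples of powers tend to `x`; it fixes the residues
  -- of the exponents modulo every integer.
  let 𝓤 : Ultrafilter (Fin M → ℤ) := Ultrafilter.of (comap (powTuple places g) (𝓝 x))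
  have hlim : Tendsto (powTuple places g) 𝓤 (𝓝 x) :=
    tendsto_comap.mono_left (Ultrafilter.of_le _)
  let E : MvPolynomial (Fin M) (fieldGen k Γ) → (Fin M → ℤ) → K := fun f a =>
    ∑ j ∈ (h f).support, algebraMap k K (h f j) * (g : K) ^ (j.1 + (fun i => (j.2 i : ℤ)) ⬝ᵥ a)
  have hE : ∀ {R : Type _} [CommRing R] (φ : K →+* R) (f) (a : Fin M → ℤ), φ (E f a) =
      ∑ j ∈ (h f).support, φ (algebraMap k K (h f j) * (g : K) ^ j.1) *
        ∏ i, φ ((g : K) ^ a i) ^ j.2 i := by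
    intro R _ φ f a
    rw [map_sum]
    refine Finset.sum_congr rfl fun j _ => ?_
    rw [zpow_add₀ g.ne_zero, ← prod_zpow_pow_eq_zpow_dotProduct g.ne_zero]
    simp only [map_mul, map_prod, map_pow, mul_assoc]
  have hconv : ∀ f ∈ s, ∀ v ∈ places, ∀ z : K, z ≠ 0 → ∀ᶠ a in 𝓤,
      v.valRing.valuation (E f a) < v.valRing.valuation z := by
    intro f hf v hv
    rw [← tendsto_embed_zero_iff]
    have hcont : Continuous fun y : Fin M → ProdUnits places =>
        ∑ j ∈ (h f).support, diag places (algebraMap k K (h f j) * (g : K) ^ j.1) *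
          ∏ i, (y i).toProd ^ j.2 i := by
      refine continuous_finsetSum _ fun d _ => continuous_const.mul
        (continuous_finsetProd _ fun i _ => Continuous.pow ?_ _)
      exact continuous_pi fun v =>
        Units.continuous_val.comp ((continuous_apply v).comp (continuous_apply i))
    have h0 := (hh f (diag places) fun i => (x i).toProd).mp (hxW f (Ideal.subset_span hf))
    have h1 := (hcont.tendsto x).comp hlim
    rw [h0] at h1
    refine ((tendsto_pi_nhds.mp h1) ⟨v, hv⟩).congr fun a => ?_
    have h2 := congrFun (hE (diag places) f a) ⟨v, hv⟩
    refine Eq.trans ?_ h2.symm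
    simp only [Function.comp_apply, powTuple]
    simp only [← Units.val_zpow_eq_zpow_val]
    rfl
  refine mem_closure_iff_nhds.mpr fun U hU => ?_
  -- `U₁` absorbs the approximation of `x` by `a`, and `V` the correction by `N • y`, where `N` is
  -- chosen before `y` is known.
  obtain ⟨U₁, hU₁, V, hV, hUV⟩ := exists_nhds_mul_nhds_one_subset hU
  obtain ⟨N, hN, hNV⟩ := exists_powTuple_nsmul_mem hgt hg hV
  obtain ⟨a, ha, y, hzero⟩ :=
    exists_common_zero_of_tendsto hcofinite hgt 𝓤 (hlim hU₁) hN s h hconv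
  refine ⟨powTuple places g (a + N • y), ?_, fun i => g ^ (a + N • y) i, ⟨fun i =>
    zpow_mem hgΓ _, ?_⟩, rfl⟩
  · rw [powTuple_add]
    exact hUV _ ha _ (hNV y)
  · refine hasPoint_of_span_eq fun f hf => (hh f (RingHom.id K) _).mpr ?_
    have := hE (RingHom.id K) f (a + N • y)
    rw [show E f (a + N • y) = 0 from hzero f hf, map_zero] at this
    simp only [Units.val_zpow_eq_zpow_val]
    exact this.symm

end ClosedVariety

end MainTheorem

theorem mainTheorem2 {k K : Type*} [Field k] [Finite k] [Field K] [Algebra k K]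
    [Algebra k⟮X⟯ K] [IsScalarTower k k⟮X⟯ K] [FunctionField k K]
    (places : Set (FFPlace k K)) (hcofinite : placesᶜ.Finite)
    (Γ : Subgroup Kˣ) (hΓ : Γ ≤ FFPlace.sUnits placesᶜ)
    (hfree : Module.Free ℤ (Additive Γ)) (hrank : Module.finrank ℤ (Additive Γ) = 1)
    {M : ℕ} (W : Ideal (MvPolynomial (Fin M) (fieldGen k Γ))) :
    ClosedVariety.adelicPoints W (FFPlace.closureGroup Γ places) =
      ClosedVariety.closurePoints W Γ places := by
  obtain ⟨g, hgΓ, hgen, hg⟩ := Γ.exists_generator_of_finrank_eq_one hfree hrank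
  have hgt : Transcendental k (g : K) :=
    transcendental_of_forall_pow_ne_one g.ne_zero fun n hn h =>
      hg n hn (Units.ext (by rw [Units.val_pow_eq_pow_val, h, Units.val_one]))
  refine (ClosedVariety.adelicPoints_subset_closurePoints hcofinite hgΓ hgen hgt
    (fun v hv => FFPlace.valuation_eq_one_of_mem_sUnits (hΓ hgΓ) fun h => h hv) W).antisymm
    (ClosedVariety.closurePoints_subset_adelicPoints W Γ places)
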